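/- For real $q$ with $0<q\le 1$ let $\rho_G$ be the operator on $\mathbb C^3\otimes\mathbb C^3$ (Alice's system first, Bob's second, orthonormal basis $|0\rangle,|1\rangle,|2\rangle$ of $\mathbb C^3$) $$\rho_G=\tfrac19\Big[q\,|\psi^-\rangle\langle\psi^-|+(3-q)\,\tfrac{\mathbb I_2}{2}\otimes|2\rangle\langle2|+2q\,|2\rangle\langle2|\otimes\tfrac{\mathbb I_2}{2}+(6-2q)\,|22\rangle\langle22|\Big],$$ where $|\psi^-\rangle=(|01\rangle-|10\rangle)/\sqrt2$ and $\mathbb I_2=|0\rangle\langle0|+|1\rangle\langle1|$. A POVM is a finite family of positive semidefinite operators summing to the identity. A state $\rho$ is steerable from Alice to Bob if there are finitely many POVMs $\{M_{a|x}\}_a$ of Alice such that the operators $\sigma_{a|x}=\operatorname{tr}_A[(M_{a|x}\otimes\mathbb I)\rho]$ cannot be written as $\sigma_{a|x}=\int p_A(a|x,\lambda)\,\sigma_\lambda\,d\pi(\lambda)$ for all $a,x$, with a probability measure $\pi$, measurable response functions $p_A$ (for every $x$ and $\lambda$ a probability distribution in $a$) and density matrices $\sigma_\lambda$ depending measurably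 on $\lambda$; steerability from Bob to Alice is defined with the roles exchanged. A state $\rho$ is local for POVMs if it has a local hidden variable model for all POVMs: for every (possibly infinite) collections of POVMs $\{M_{a|x}\}_a$ of Alice and $\{N_{b|y}\}_b$ of Bob there are a probability measure $\pi$ and measurable response functions $p_A,p_B$ with $\operatorname{tr}[\rho\,(M_{a|x}\otimes N_{b|y})]=\int p_A(a|x,\lambda)\,p_B(b|y,\lambda)\,d\pi(\lambda)$ for all $a,b,x,y$. Then for every $0<q\le1$ the operator $\rho_G$ is a density matrix (positive semidefinite with trace $1$) that is steerable both from Alice to Bob and from Bob to Alice, and for every $0<q\le\tfrac12$ it is moreover local for POVMs. -/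

import Mathlib

open scoped Kronecker ComplexOrder
open MeasureTheory

noncomputable section

namespace QSteering

/-- A density matrix (quantum state): positive semidefinite with unit trace. -/
def IsDensityMatrix {n : Type} [Fintype n] (ρ : Matrix n n ℂ) : Prop :=
  ρ.PosSemidef ∧ ρ.trace = 1

/-- A POVM on `ℂⁿ` with finitely many outcomes `a : A`. -/
structure POVM (A n : Type) [Fintype A] [Fintype n] [DecidableEq n] where
  effect : A → Matrix n n ℂ
  posSemidef : ∀ a, (effect a).PosSemidef
  sum_eq_one : ∑ a, effect a = 1

/-- The partial trace over the first tensor factor. -/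
def trFst {m n : Type} [Fintype m] (R : Matrix (m × n) (m × n) ℂ) : Matrix n n ℂ :=
  Matrix.of fun j j' => ∑ i, R (i, j) (i, j')

/-- The partial trace over the second tensor factor. -/
def trSnd {m n : Type} [Fintype n] (R : Matrix (m × n) (m × n) ℂ) : Matrix m m ℂ :=
  Matrix.of fun i i' => ∑ j, R (i, j) (i', j)

/-- Local response functions `p(a|x,l)`: for every setting `x` and every value `l` of the hidden
variable a probability distribution on the outcomes of `x`, depending measurably on `l`. -/
structure IsResponse {X : Type} {A : X → Type} [∀ x, Fintype (A x)]
    {L : Type} [MeasurableSpace L] (p : ∀ x, A x → L → ℝ) : Prop where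
  measurable : ∀ x a, Measurable (p x a)
  nonneg : ∀ x a l, 0 ≤ p x a l
  sum_eq_one : ∀ x l, ∑ a, p x a l = 1

/-- Bell locality of a family of numbers `p(ab|xy)`:
`p(ab|xy) = ∫ p_A(a|x,l) p_B(b|y,l) dπ(l)` for a hidden variable `l` with law `π`. -/
def IsBellLocal {X Y : Type} {A : X → Type} {B : Y → Type}
    [∀ x, Fintype (A x)] [∀ y, Fintype (B y)]
    (p : ∀ x y, A x → B y → ℂ) : Prop :=
  ∃ (L : Type) (_ : MeasurableSpace L) (π : Measure L) (_ : IsProbabilityMeasure π)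
    (pA : ∀ x, A x → L → ℝ) (pB : ∀ y, B y → L → ℝ),
    IsResponse pA ∧ IsResponse pB ∧
      ∀ x y a b, p x y a b = ((∫ l, pA x a l * pB y b l ∂π : ℝ) : ℂ)

/-- The assemblage `σ_{a|x}` has a local hidden state decomposition:
`σ_{a|x} = ∫ p(a|x,l) σ_l dπ(l)` (entrywise) with density matrices `σ_l`. -/
def HasLHSDecomposition {X : Type} {A : X → Type} [∀ x, Fintype (A x)]
    {n : Type} [Fintype n] (σ : ∀ x, A x → Matrix n n ℂ) : Prop :=
  ∃ (L : Type) (_ : MeasurableSpace L) (π : Measure L) (_ : IsProbabilityMeasure π)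
    (p : ∀ x, A x → L → ℝ) (τ : L → Matrix n n ℂ),
    IsResponse p ∧ (∀ i j, Measurable fun l => τ l i j) ∧ (∀ l, IsDensityMatrix (τ l)) ∧
      ∀ x a i j, σ x a i j = ∫ l, (p x a l : ℂ) * τ l i j ∂π

variable {m n : Type} [Fintype m] [DecidableEq m] [Fintype n] [DecidableEq n]

/-- The state `ρ` is local for POVMs: for every (possibly infinite) collection of POVMs of Alice
and of Bob, the resulting statistics `tr (ρ (M_{a|x} ⊗ N_{b|y}))` are Bell local. The collections
may consist of all POVMs, and then one hidden variable serves all of them. -/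
def IsLocalForPOVMs (ρ : Matrix (m × n) (m × n) ℂ) : Prop :=
  ∀ (X Y : Type) (A : X → Type) (B : Y → Type) [∀ x, Fintype (A x)] [∀ y, Fintype (B y)]
    (M : ∀ x, POVM (A x) m) (N : ∀ y, POVM (B y) n),
    IsBellLocal fun x y a b => (ρ * ((M x).effect a ⊗ₖ (N y).effect b)).trace

/-- Alice can steer Bob: for some finite collection of POVMs of Alice, the assemblage
`tr_A ((M_{a|x} ⊗ 1) ρ)` prepared on Bob's side has no local hidden state decomposition. -/
def IsSteerableAliceToBob (ρ : Matrix (m × n) (m × n) ℂ) : Prop :=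
  ∃ (X : Type) (_ : Finite X) (A : X → Type) (_ : ∀ x, Fintype (A x)) (M : ∀ x, POVM (A x) m),
    ¬ HasLHSDecomposition fun x a => trFst (((M x).effect a ⊗ₖ (1 : Matrix n n ℂ)) * ρ)

/-- Bob can steer Alice: for some finite collection of POVMs of Bob, the assemblage
`tr_B ((1 ⊗ N_{b|y}) ρ)` prepared on Alice's side has no local hidden state decomposition. -/
def IsSteerableBobToAlice (ρ : Matrix (m × n) (m × n) ℂ) : Prop :=
  ∃ (Y : Type) (_ : Finite Y) (B : Y → Type) (_ : ∀ y, Fintype (B y)) (N : ∀ y, POVM (B y) n),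
    ¬ HasLHSDecomposition fun y b => trSnd (((1 : Matrix m m ℂ) ⊗ₖ (N y).effect b) * ρ)

/-- The vector `|ij⟩ = |i⟩ ⊗ |j⟩` of `ℂ³ ⊗ ℂ³`. -/
def ket (i j : Fin 3) : Fin 3 × Fin 3 → ℂ := Pi.single (i, j) 1

/-- The singlet vector `|ψ⁻⟩ = (|01⟩ - |10⟩) / √2`. -/
def singlet : Fin 3 × Fin 3 → ℂ := ((1 / Real.sqrt 2 : ℝ) : ℂ) • (ket 0 1 - ket 1 0)

/-- The operator `|ψ⁻⟩⟨ψ⁻|`. -/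
def singletProj : Matrix (Fin 3 × Fin 3) (Fin 3 × Fin 3) ℂ :=
  Matrix.vecMulVec singlet (star singlet)

/-- The operator `|i⟩⟨i|` on `ℂ³`. -/
def ketbra (i : Fin 3) : Matrix (Fin 3) (Fin 3) ℂ := Matrix.single i i 1

/-- The identity `𝕀₂` of the qubit subspace spanned by `|0⟩` and `|1⟩`, as an operator on `ℂ³`. -/
def qubitId : Matrix (Fin 3) (Fin 3) ℂ := ketbra 0 + ketbra 1

/-- The state `ρ_G = (1/9) [q |ψ⁻⟩⟨ψ⁻| + (3-q) (𝕀₂/2) ⊗ |2⟩⟨2| + 2q |2⟩⟨2| ⊗ (𝕀₂/2)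
+ (6-2q) |22⟩⟨22|]`. -/
def rhoG (q : ℝ) : Matrix (Fin 3 × Fin 3) (Fin 3 × Fin 3) ℂ :=
  (1 / 9 : ℂ) •
    ((q : ℂ) • singletProj
      + (3 - q : ℂ) • (((1 / 2 : ℂ) • qubitId) ⊗ₖ ketbra 2)
      + (2 * q : ℂ) • (ketbra 2 ⊗ₖ ((1 / 2 : ℂ) • qubitId))
      + (6 - 2 * q : ℂ) • (ketbra 2 ⊗ₖ ketbra 2))

end QSteering

end

open scoped Kronecker ComplexOrder
open MeasureTheory

noncomputable section

namespace QSteering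

/-! Locality. Let ρ_E = q|ψ⁻⟩⟨ψ⁻| + (1-q)(𝕀₂/2)⊗|2⟩⟨2|, with marginals ρ_A = 𝕀₂/2 and ρ_B = q𝕀₂/2 +
(1-q)|2⟩⟨2|. Then ρ_G = (1/9)[ρ_E + 2ρ_A⊗|2⟩⟨2| + 2|2⟩⟨2|⊗ρ_B + 4|22⟩⟨22|]. Each effect splits into
rank-one pieces ww*, and a random direction in space decides acceptance of each piece: Alice by the
sign of its component along the Bloch vector, Bob with a probability depending on that component.
The products average to the statistics of ρ_E (`erasureStat_vecMulVec`). These tests lie between 0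
and ‖w‖², so over a POVM they sum to at most tr 𝕀 = 3 rather than to 1. Answering by them with
weight 1/3, and otherwise as |2⟩ would, gives genuine responses whose correlations are exactly those
of ρ_G (`integral_completion_mul_completion`).

Steering. Projecting one side onto |0⟩ + k|1⟩ leaves the other side's qubit block pure, killed by
(1, k). In a hidden state model, a hidden state with nonzero qubit block can contribute to this
outcome for at most one k. K outcomes of block trace ε thus need Kε ≤ W, with W the total block
trace; enough values of k violate this (`not_hasLHSDecomposition_of_pure_outcomes`). -/

/-! ### Averages over a uniformly random direction. -/

open Set Metric Measure Module in
/-- Integration in polar coordinates of a product of an angular and a radial function. -/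
theorem integral_angular_mul_radial {E : Type*} [NormedAddCommGroup E] [NormedSpace ℝ E]
    [MeasurableSpace E] [BorelSpace E] [Nontrivial E] [FiniteDimensional ℝ E]
    (μ : Measure E) [μ.IsAddHaarMeasure] (F : E → ℝ) (f : ℝ → ℝ) :
    ∫ x, F (‖x‖⁻¹ • x) * f ‖x‖ ∂μ =
      (∫ s, F s ∂μ.toSphere) * ∫ y in Ioi (0 : ℝ), y ^ (finrank ℝ E - 1) * f y :=
  calc
    ∫ x, F (‖x‖⁻¹ • x) * f ‖x‖ ∂μ
      = ∫ x : ({(0)}ᶜ : Set E), F (‖x.1‖⁻¹ • x.1) * f ‖x.1‖ ∂(μ.comap (↑)) := by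
      rw [integral_subtype_comap (measurableSet_singleton _).compl
        fun x ↦ F (‖x‖⁻¹ • x) * f ‖x‖, restrict_compl_singleton]
    _ = ∫ x, F x.1 * f x.2 ∂μ.toSphere.prod (.volumeIoiPow (finrank ℝ E - 1)) := by
      simpa using μ.measurePreserving_homeomorphUnitSphereProd.integral_comp
        (Homeomorph.measurableEmbedding _)
        (fun x : sphere (0 : E) 1 × Ioi (0 : ℝ) => F x.1 * f x.2)
    _ = (∫ s, F s ∂μ.toSphere) * ∫ x : Ioi (0 : ℝ), f x ∂.volumeIoiPow (finrank ℝ E - 1) :=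
      integral_prod_mul (fun s : sphere (0 : E) 1 => F s) (fun x : Ioi (0 : ℝ) => f x)
    _ = _ := by
      simp only [Measure.volumeIoiPow, ENNReal.ofReal]
      rw [integral_withDensity_eq_integral_smul,
        integral_subtype_comap measurableSet_Ioi
          fun a ↦ Real.toNNReal (a ^ (finrank ℝ E - 1)) • f a,
        setIntegral_congr_fun measurableSet_Ioi fun x hx ↦ ?_]
      · rw [NNReal.smul_def, Real.coe_toNNReal _ (pow_nonneg hx.out.le _), smul_eq_mul]
      · exact (measurable_subtype_coe.pow_const _).real_toNNReal

/-- Real three-space, home of the Bloch vectors. -/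
abbrev R3 : Type := EuclideanSpace ℝ (Fin 3)

theorem integral_pow_mul_exp_neg_sq (n : ℕ) :
    ∫ y in Set.Ioi (0 : ℝ), y ^ n * Real.exp (-y ^ 2) = 1 / 2 * Real.Gamma ((n + 1) / 2) := by
  have := integral_rpow_mul_exp_neg_rpow (p := 2) (q := n) (by norm_num)
    (by have : (0 : ℝ) ≤ n := n.cast_nonneg
        linarith)
  rw [← this]
  refine setIntegral_congr_fun measurableSet_Ioi fun y _ => ?_
  simp

theorem integral_abs_mul_exp_neg_sq : ∫ x : ℝ, |x| * Real.exp (-x ^ 2) = 1 := by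
  have := integral_comp_abs (f := fun x => x * Real.exp (-x ^ 2))
  simp only [sq_abs] at this
  rw [this]
  have h := integral_pow_mul_exp_neg_sq 1
  norm_num at h
  rw [h]
  norm_num

theorem integral_exp_neg_norm_sq_mul (g : Fin 3 → ℝ → ℝ) :
    ∫ x : R3, (∏ i, g i (x i)) * Real.exp (-‖x‖ ^ 2) =
      ∏ i, ∫ t, g i t * Real.exp (-t ^ 2) := by
  rw [← integral_fintype_prod_volume_eq_prod (fun i t => g i t * Real.exp (-t ^ 2)),
    ← (EuclideanSpace.volume_preserving_symm_measurableEquiv_toLp (Fin 3)).integral_comp'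
      (f := (MeasurableEquiv.toLp 2 (Fin 3 → ℝ)).symm)]
  refine integral_congr_ae (.of_forall fun x => ?_)
  simp [EuclideanSpace.norm_sq_eq, Fin.prod_univ_three, Fin.sum_univ_three, Real.exp_add]
  ring

/-- The integral of |x₂| exp(-‖x‖²) over space is computed twice: as a product of one-dimensional
integrals it is π, in polar coordinates it is the wanted surface integral times 1/2. -/
theorem integral_toSphere_abs_coord :
    ∫ s, |(s : R3) 2| ∂(volume : Measure R3).toSphere = 2 * Real.pi := by
  have h := integral_angular_mul_radial (volume : Measure R3) (fun x => |x 2|)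
    (fun r => r * Real.exp (-r ^ 2))
  have h1 := integral_exp_neg_norm_sq_mul (fun i t => if i = 2 then |t| else 1)
  have hg : ∫ x : ℝ, Real.exp (-x ^ 2) = √Real.pi := by simpa using integral_gaussian 1
  simp [Fin.prod_univ_three, integral_abs_mul_exp_neg_sq, hg] at h1
  have h2 : ∫ x : R3, |(‖x‖⁻¹ • x) 2| * (‖x‖ * Real.exp (-‖x‖ ^ 2)) = Real.pi := by
    rw [← Real.mul_self_sqrt Real.pi_pos.le, ← h1]
    refine integral_congr_ae (.of_forall fun x => ?_)
    rcases eq_or_ne x 0 with rfl | hx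
    · simp
    · have : ‖x‖ ≠ 0 := norm_ne_zero_iff.2 hx
      simp [abs_mul]
      field_simp
  rw [h2] at h
  have h3 := integral_pow_mul_exp_neg_sq 3
  norm_num at h3
  have h4 : ∫ y in Set.Ioi (0 : ℝ), y ^ 2 * (y * Real.exp (-y ^ 2)) = 1 / 2 := by
    rw [← h3]
    congr 1 with y
    ring
  simp [h4] at h
  linarith

/-- The uniform distribution on the unit ball, the law of the hidden variable. -/
def ballLaw : Measure R3 := ProbabilityTheory.cond volume (Metric.ball 0 1)

instance : IsProbabilityMeasure ballLaw :=
  ProbabilityTheory.cond_isProbabilityMeasure_of_finite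
    (Metric.measure_ball_pos _ _ one_pos).ne' measure_ball_lt_top.ne

/-- The radial integral 1/3 divided by the volume 4π/3 of the ball gives 1/(4π): the direction of
the hidden variable is uniform on the sphere. -/
theorem integral_ballLaw_angular (F : R3 → ℝ) :
    ∫ x, F (‖x‖⁻¹ • x) ∂ballLaw =
      (4 * Real.pi)⁻¹ * ∫ s, F s ∂(volume : Measure R3).toSphere := by
  have h := integral_angular_mul_radial (volume : Measure R3) F
    ((Set.Iio 1).indicator fun _ => 1)
  have h3 : ∫ y in Set.Ioi (0 : ℝ), y ^ 2 * (Set.Iio 1).indicator (fun _ => (1 : ℝ)) y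
      = 1 / 3 := by
    have (y : ℝ) : y ^ 2 * (Set.Iio 1).indicator (fun _ => (1 : ℝ)) y =
        (Set.Iio 1).indicator (fun y => y ^ 2) y := by
      by_cases hy : y < 1 <;> simp [hy]
    simp only [this]
    rw [setIntegral_indicator measurableSet_Iio, Set.Ioi_inter_Iio,
      ← integral_Ioc_eq_integral_Ioo, ← intervalIntegral.integral_of_le zero_le_one]
    norm_num
  have hb : ∫ x : R3, F (‖x‖⁻¹ • x) * (Set.Iio 1).indicator (fun _ => (1 : ℝ)) ‖x‖ =
      ∫ x in Metric.ball (0 : R3) 1, F (‖x‖⁻¹ • x) := by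
    rw [← integral_indicator measurableSet_ball]
    refine integral_congr_ae (.of_forall fun x => ?_)
    by_cases hx : ‖x‖ < 1 <;> simp [hx]
  have hv : (volume : Measure R3).real (Metric.ball 0 1) = 4 / 3 * Real.pi := by
    rw [measureReal_def, EuclideanSpace.volume_ball_fin_three]
    rw [ENNReal.ofReal_one, one_pow, one_mul, ENNReal.toReal_ofReal (by positivity)]
    ring
  rw [hb, finrank_euclideanSpace_fin, h3] at h
  rw [ballLaw, ProbabilityTheory.cond, integral_smul_measure, h, ENNReal.toReal_inv,
    ← measureReal_def, hv]
  have := Real.pi_pos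
  simp
  field_simp

theorem measurePreserving_ballLaw (f : R3 ≃ₗᵢ[ℝ] R3) : MeasurePreserving f ballLaw ballLaw := by
  have h := f.measurePreserving.restrict_preimage (s := Metric.ball 0 1) measurableSet_ball
  have hs : f ⁻¹' Metric.ball 0 1 = Metric.ball 0 1 := by
    simp
  rw [hs] at h
  exact h.smul_measure _

theorem integral_ballLaw_comp (f : R3 ≃ₗᵢ[ℝ] R3) (g : R3 → ℝ) :
    ∫ x, g (f x) ∂ballLaw = ∫ x, g x ∂ballLaw :=
  (measurePreserving_ballLaw f).integral_comp f.toHomeomorph.measurableEmbedding g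

theorem integral_ballLaw_eq_zero_of_odd {g : R3 → ℝ} (h : ∀ x, g (-x) = -g x) :
    ∫ x, g x ∂ballLaw = 0 := by
  have := integral_ballLaw_comp (LinearIsometryEquiv.neg ℝ) g
  simp only [LinearIsometryEquiv.coe_neg, h, integral_neg] at this
  linarith

/-- The component of the direction of `x` along `v`. -/
def dirInner (v x : R3) : ℝ := inner ℝ v (‖x‖⁻¹ • x)

theorem dirInner_eq (v x : R3) : dirInner v x = ‖x‖⁻¹ * inner ℝ v x := inner_smul_right _ _ _

theorem dirInner_map (f : R3 ≃ₗᵢ[ℝ] R3) (v x : R3) : dirInner (f v) (f x) = dirInner v x := by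
  simp [dirInner_eq]

@[fun_prop]
theorem measurable_dirInner (v : R3) : Measurable (dirInner v) := by
  unfold dirInner
  fun_prop

theorem abs_dirInner_le (v x : R3) : |dirInner v x| ≤ ‖v‖ := by
  refine (abs_real_inner_le_norm _ _).trans (mul_le_of_le_one_right (norm_nonneg _) ?_)
  rw [norm_smul, norm_inv, norm_norm]
  exact inv_mul_le_one

theorem dirInner_neg (v x : R3) : dirInner v (-x) = -dirInner v x := by
  simp [dirInner_eq]

theorem integrable_dirInner (v : R3) : Integrable (dirInner v) ballLaw :=
  .of_bound (measurable_dirInner v).aestronglyMeasurable ‖v‖ (.of_forall (abs_dirInner_le v))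

/-- The mean of |cos θ| over the sphere is 2π/(4π) = 1/2; a reflection carries the third axis to the
direction of `v`. -/
theorem integral_abs_dirInner (v : R3) : ∫ x, |dirInner v x| ∂ballLaw = ‖v‖ / 2 := by
  have h0 : ∫ x, |dirInner (EuclideanSpace.single 2 1) x| ∂ballLaw = 1 / 2 := by
    have := integral_ballLaw_angular fun x => |inner ℝ (EuclideanSpace.single 2 1 : R3) x|
    simp only [dirInner]
    rw [this]
    simp only [EuclideanSpace.inner_single_left, map_one, one_mul, integral_toSphere_abs_coord]
    have := Real.pi_pos
    field_simp
    norm_num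
  have h1 : ‖v‖ = ‖(‖v‖ • EuclideanSpace.single 2 1 : R3)‖ := by simp [norm_smul]
  set R := Submodule.reflection (ℝ ∙ (‖v‖ • EuclideanSpace.single 2 1 - v))ᗮ
  have hv : R (‖v‖ • EuclideanSpace.single 2 1) = v := Submodule.reflection_sub h1.symm
  rw [← integral_ballLaw_comp R]
  have (x : R3) : |dirInner v (R x)| = ‖v‖ * |dirInner (EuclideanSpace.single 2 1) x| := by
    nth_rewrite 1 [← hv]
    rw [dirInner_map, dirInner_eq, real_inner_smul_left, dirInner_eq, mul_left_comm, abs_mul,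
      abs_norm]
  simp only [this, integral_const_mul, h0]
  ring

@[fun_prop]
theorem measurable_real_sign : Measurable Real.sign := by
  unfold Real.sign
  exact Measurable.ite measurableSet_Iio measurable_const
    (Measurable.ite measurableSet_Ioi measurable_const measurable_const)

theorem abs_real_sign_le (r : ℝ) : |Real.sign r| ≤ 1 := by
  rcases Real.sign_apply_eq r with h | h | h <;> simp [h]

/-- Only the part of `v` along `u` survives: the reflection negating the orthogonal part `w` fixes
`u` and makes that contribution odd. The factor `‖u‖` covers `u = 0` and matches the weight in
`aliceTest`. -/
theorem norm_mul_integral_sign_mul_dirInner (u v : R3) :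
    ‖u‖ * ∫ x, Real.sign (inner ℝ u x) * dirInner v x ∂ballLaw = inner ℝ u v / 2 := by
  rcases eq_or_ne u 0 with rfl | hu
  · simp
  have hn : ‖u‖ ≠ 0 := norm_ne_zero_iff.2 hu
  set c : ℝ := inner ℝ u v / ‖u‖ ^ 2 with hc
  set w : R3 := v - c • u with hw
  have huw : inner ℝ u w = 0 := by
    rw [hw, inner_sub_right, inner_smul_right, real_inner_self_eq_norm_sq, hc]
    field_simp
    ring
  have hint (y : R3) : Integrable (fun x => Real.sign (inner ℝ u x) * dirInner y x) ballLaw := by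
    refine .of_bound (C := ‖y‖) (by fun_prop) (.of_forall fun x => ?_)
    rw [norm_mul]
    exact (mul_le_of_le_one_left (norm_nonneg _) (abs_real_sign_le _)).trans (abs_dirInner_le y x)
  have hzero : ∫ x, Real.sign (inner ℝ u x) * dirInner w x ∂ballLaw = 0 := by
    set R := Submodule.reflection (ℝ ∙ w)ᗮ
    have hRw : R w = -w := Submodule.reflection_orthogonalComplement_singleton_eq_neg w
    have hRu : R u = u := Submodule.reflection_mem_subspace_eq_self
      (Submodule.mem_orthogonal_singleton_iff_inner_left.2 huw)
    have h := integral_ballLaw_comp R fun x => Real.sign (inner ℝ u x) * dirInner w x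
    have h1 (x : R3) : inner ℝ u (R x) = inner ℝ u x := by
      conv_lhs => rw [← hRu, R.inner_map_map]
    have h2 (x : R3) : dirInner w (R x) = -dirInner w x := by
      have := dirInner_map R (-w) x
      rw [map_neg, hRw, neg_neg] at this
      rw [this, dirInner_eq, dirInner_eq, inner_neg_left, mul_neg]
    simp only [h1, h2, mul_neg, integral_neg] at h
    linarith
  have hsplit (x : R3) : Real.sign (inner ℝ u x) * dirInner v x =
      c * |dirInner u x| + Real.sign (inner ℝ u x) * dirInner w x := by
    have : |dirInner u x| = Real.sign (inner ℝ u x) * dirInner u x := by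
      rw [dirInner_eq, abs_mul, abs_of_nonneg (by positivity), mul_left_comm]
      congr 1
      rcases lt_trichotomy (inner ℝ u x : ℝ) 0 with h | h | h
      · rw [Real.sign_of_neg h, abs_of_neg h]; ring
      · simp [h]
      · rw [Real.sign_of_pos h, abs_of_pos h]; ring
    rw [this, hw, dirInner_eq, dirInner_eq, dirInner_eq, inner_sub_left, real_inner_smul_left]
    ring
  simp only [hsplit]
  rw [integral_add ((integrable_dirInner u).abs.const_mul c) (hint w), hzero, integral_const_mul,
    integral_abs_dirInner, hc]
  field_simp
  ring

/-! ### Statistics of the state on product operators. -/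

theorem trace_singletProj_mul_kronecker (M N : Matrix (Fin 3) (Fin 3) ℂ) :
    (singletProj * (M ⊗ₖ N)).trace =
      (1 / 2) * (M 0 0 * N 1 1 - M 0 1 * N 1 0 - M 1 0 * N 0 1 + M 1 1 * N 0 0) := by
  have h2 : ((1 / Real.sqrt 2 : ℝ) : ℂ) * ((1 / Real.sqrt 2 : ℝ) : ℂ) = 1 / 2 := by
    rw [← Complex.ofReal_mul, div_mul_div_comm, Real.mul_self_sqrt (by norm_num)]
    norm_num
  rw [singletProj, Matrix.vecMulVec_mul, Matrix.trace_vecMulVec]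
  simp only [singlet, ket, star_smul, Matrix.smul_vecMul, dotProduct_smul, smul_dotProduct,
    smul_eq_mul]
  rw [← mul_assoc, show star ((1 / Real.sqrt 2 : ℝ) : ℂ) = ((1 / Real.sqrt 2 : ℝ) : ℂ) from
    Complex.conj_ofReal _, h2]
  simp [Matrix.sub_vecMul, sub_dotProduct, dotProduct_sub]
  ring

theorem trace_ketbra_mul (i : Fin 3) (M : Matrix (Fin 3) (Fin 3) ℂ) :
    (ketbra i * M).trace = M i i := by
  simp [ketbra, Matrix.trace_single_mul]

theorem trace_rhoG_mul_kronecker (q : ℝ) (M N : Matrix (Fin 3) (Fin 3) ℂ) :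
    (rhoG q * (M ⊗ₖ N)).trace =
      (1 / 9) * ((q / 2) * (M 0 0 * N 1 1 - M 0 1 * N 1 0 - M 1 0 * N 0 1 + M 1 1 * N 0 0)
        + (3 - q) / 2 * ((M 0 0 + M 1 1) * N 2 2) + q * (M 2 2 * (N 0 0 + N 1 1))
        + (6 - 2 * q) * (M 2 2 * N 2 2)) := by
  simp only [rhoG, Matrix.add_mul, Matrix.smul_mul, Matrix.trace_add, Matrix.trace_smul,
    trace_singletProj_mul_kronecker, ← Matrix.mul_kronecker_mul, Matrix.trace_kronecker,
    qubitId, trace_ketbra_mul, smul_eq_mul]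
  ring

theorem isDensityMatrix_rhoG {q : ℝ} (hq : 0 < q) (hq1 : q ≤ 1) : IsDensityMatrix (rhoG q) := by
  have hk (i : Fin 3) : (ketbra i).PosSemidef := by
    have := Matrix.posSemidef_vecMulVec_self_star (Pi.single i 1 : Fin 3 → ℂ)
    rwa [← Pi.single_star, star_one, ← Matrix.single_eq_single_vecMulVec_single] at this
  have hI : ((1 / 2 : ℂ) • qubitId).PosSemidef := ((hk 0).add (hk 1)).smul (by simp)
  have hc {x : ℝ} (hx : 0 ≤ x) : (0 : ℂ) ≤ x := by exact_mod_cast hx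
  refine ⟨Matrix.PosSemidef.smul (((Matrix.PosSemidef.add ?_ ?_).add ?_).add ?_) (by simp), ?_⟩
  · exact (Matrix.posSemidef_vecMulVec_self_star _).smul (hc hq.le)
  · exact (hI.kronecker (hk 2)).smul (by exact_mod_cast hc (x := 3 - q) (by linarith))
  · exact ((hk 2).kronecker hI).smul (by exact_mod_cast hc (x := 2 * q) (by linarith))
  · exact ((hk 2).kronecker (hk 2)).smul (by exact_mod_cast hc (x := 6 - 2 * q) (by linarith))
  · have := trace_rhoG_mul_kronecker q 1 1
    rw [Matrix.one_kronecker_one, mul_one] at this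
    rw [this]
    simp
    ring

/-- Pairing with matrix units lets the trace formula for ρ_G compute steering assemblages entry by
entry. -/
theorem trFst_apply_eq_trace {m n : Type} [Fintype m] [DecidableEq m] [Fintype n] [DecidableEq n]
    (M : Matrix m m ℂ) (ρ : Matrix (m × n) (m × n) ℂ) (i j : n) :
    trFst ((M ⊗ₖ (1 : Matrix n n ℂ)) * ρ) i j = (ρ * (M ⊗ₖ Matrix.single j i 1)).trace := by
  rw [Matrix.trace_mul_comm]
  simp only [trFst, Matrix.of_apply, Matrix.trace, Matrix.diag, Fintype.sum_prod_type,
    Matrix.mul_apply, Matrix.kroneckerMap_apply, Matrix.one_apply, Matrix.single_apply]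
  simp [ite_and, Finset.sum_ite_eq]

theorem trSnd_apply_eq_trace {m n : Type} [Fintype m] [DecidableEq m] [Fintype n] [DecidableEq n]
    (N : Matrix n n ℂ) (ρ : Matrix (m × n) (m × n) ℂ) (i j : m) :
    trSnd (((1 : Matrix m m ℂ) ⊗ₖ N) * ρ) i j = (ρ * (Matrix.single j i 1 ⊗ₖ N)).trace := by
  rw [Matrix.trace_mul_comm]
  simp only [trSnd, Matrix.of_apply, Matrix.trace, Matrix.diag, Fintype.sum_prod_type,
    Matrix.mul_apply, Matrix.kroneckerMap_apply, Matrix.one_apply, Matrix.single_apply]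
  simp [ite_and, Finset.sum_ite_eq]

/-! ### Hidden-variable tests reproducing the erased singlet. -/

/-- The squared norm of the component of `w` in the qubit subspace. -/
def qubitWeight (w : Fin 3 → ℂ) : ℝ := Complex.normSq (w 0) + Complex.normSq (w 1)

/-- The Bloch vector of the component of `w` in the qubit subspace. -/
def blochVec (w : Fin 3 → ℂ) : R3 :=
  !₂[2 * (w 0 * star (w 1)).re, 2 * (w 0 * star (w 1)).im,
    Complex.normSq (w 0) - Complex.normSq (w 1)]

theorem qubitWeight_nonneg (w : Fin 3 → ℂ) : 0 ≤ qubitWeight w :=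
  add_nonneg (Complex.normSq_nonneg _) (Complex.normSq_nonneg _)

theorem norm_blochVec (w : Fin 3 → ℂ) : ‖blochVec w‖ = qubitWeight w := by
  rw [EuclideanSpace.norm_eq, Real.sqrt_eq_iff_mul_self_eq (by positivity) (qubitWeight_nonneg w)]
  simp [Fin.sum_univ_three, blochVec, qubitWeight, Complex.normSq_apply]
  ring

/-- Alice's probability of accepting the (unnormalized) vector `w`. -/
def aliceTest (w : Fin 3 → ℂ) (x : R3) : ℝ :=
  qubitWeight w * (1 + Real.sign (inner ℝ (blochVec w) x)) / 2

/-- Bob's probability of accepting the (unnormalized) vector `w`. -/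
def bobTest (q : ℝ) (w : Fin 3 → ℂ) (x : R3) : ℝ :=
  q * (|dirInner (blochVec w) x| - dirInner (blochVec w) x) + (1 - q) * Complex.normSq (w 2)

@[fun_prop]
theorem measurable_aliceTest (w : Fin 3 → ℂ) : Measurable (aliceTest w) := by
  unfold aliceTest
  fun_prop

@[fun_prop]
theorem measurable_bobTest (q : ℝ) (w : Fin 3 → ℂ) : Measurable (bobTest q w) := by
  unfold bobTest
  fun_prop

theorem sum_normSq_eq (w : Fin 3 → ℂ) :
    ∑ i, Complex.normSq (w i) = qubitWeight w + Complex.normSq (w 2) :=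
  Fin.sum_univ_three _

theorem aliceTest_mem_Icc (w : Fin 3 → ℂ) (x : R3) :
    aliceTest w x ∈ Set.Icc 0 (∑ i, Complex.normSq (w i)) := by
  have h := abs_le.1 (abs_real_sign_le (inner ℝ (blochVec w) x))
  have hn := qubitWeight_nonneg w
  have h2 := Complex.normSq_nonneg (w 2)
  rw [sum_normSq_eq, aliceTest]
  constructor
  · have : 0 ≤ 1 + Real.sign (inner ℝ (blochVec w) x) := by linarith
    positivity
  · nlinarith

/-- |d| - d can be as large as twice the qubit weight, so the upper bound needs 2q ≤ 1. This is the
source of the threshold q ≤ 1/2. -/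
theorem bobTest_mem_Icc {q : ℝ} (hq : 0 ≤ q) (hq2 : q ≤ 1 / 2) (w : Fin 3 → ℂ) (x : R3) :
    bobTest q w x ∈ Set.Icc 0 (∑ i, Complex.normSq (w i)) := by
  have h := abs_dirInner_le (blochVec w) x
  rw [norm_blochVec] at h
  have h1 := le_abs_self (dirInner (blochVec w) x)
  have h1' := neg_le_abs (dirInner (blochVec w) x)
  have hn := qubitWeight_nonneg w
  have h2 := Complex.normSq_nonneg (w 2)
  rw [sum_normSq_eq, bobTest]
  constructor
  · have : 0 ≤ |dirInner (blochVec w) x| - dirInner (blochVec w) x := by linarith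
    have : 0 ≤ 1 - q := by linarith
    positivity
  · have := mul_le_mul_of_nonneg_left
      (show |dirInner (blochVec w) x| - dirInner (blochVec w) x ≤ 2 * qubitWeight w by linarith) hq
    nlinarith

theorem integral_bobTest (q : ℝ) (w : Fin 3 → ℂ) :
    ∫ x, bobTest q w x ∂ballLaw = q * qubitWeight w / 2 + (1 - q) * Complex.normSq (w 2) := by
  have hd := integrable_dirInner (blochVec w)
  have hdd : Integrable (fun x => |dirInner (blochVec w) x| - dirInner (blochVec w) x) ballLaw :=
    hd.abs.sub hd
  unfold bobTest
  rw [integral_add (hdd.const_mul q) (integrable_const _), integral_const_mul,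
    integral_sub hd.abs hd, integral_abs_dirInner, norm_blochVec,
    integral_ballLaw_eq_zero_of_odd (dirInner_neg _)]
  simp
  ring

theorem real_sign_inner_neg (u x : R3) :
    Real.sign (inner ℝ u (-x)) = -Real.sign (inner ℝ u x) := by
  rw [inner_neg_right, Real.sign_neg]

theorem integrable_sign_mul {f : R3 → ℝ} (hf : Integrable f ballLaw) (u : R3) :
    Integrable (fun x => Real.sign (inner ℝ u x) * f x) ballLaw :=
  hf.bdd_mul (c := 1)
    (measurable_real_sign.comp (by fun_prop)).aestronglyMeasurable (.of_forall fun x => abs_real_sign_le _)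

theorem integral_aliceTest (w : Fin 3 → ℂ) :
    ∫ x, aliceTest w x ∂ballLaw = qubitWeight w / 2 := by
  have h := integral_ballLaw_eq_zero_of_odd (g := fun x => Real.sign (inner ℝ (blochVec w) x))
    (real_sign_inner_neg (blochVec w))
  have hi : Integrable (fun x => Real.sign (inner ℝ (blochVec w) x)) ballLaw := by
    simpa using integrable_sign_mul (integrable_const (1 : ℝ)) (blochVec w)
  unfold aliceTest
  rw [integral_div, integral_const_mul, integral_add (integrable_const _) hi, h]
  simp

/-- Terms odd under x ↦ -x, collected in `g`, integrate to zero. What remains is a constant, the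
mean of |d|, and the sign correlation that produces the inner product of the Bloch vectors. -/
theorem integral_aliceTest_mul_bobTest (q : ℝ) (w v : Fin 3 → ℂ) :
    ∫ x, aliceTest w x * bobTest q v x ∂ballLaw =
      q * (qubitWeight w * qubitWeight v - inner ℝ (blochVec w) (blochVec v)) / 4
        + (1 - q) * qubitWeight w * Complex.normSq (v 2) / 2 := by
  set n := qubitWeight w
  set c := Complex.normSq (v 2)
  set s : R3 → ℝ := fun x => Real.sign (inner ℝ (blochVec w) x) with hs
  set d := dirInner (blochVec v)
  have hd : Integrable d ballLaw := integrable_dirInner _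
  have hsd : Integrable (fun x => s x * d x) ballLaw := integrable_sign_mul hd _
  set g : R3 → ℝ := fun x => n / 2 * (q * (s x * |d x|) - q * d x + (1 - q) * c * s x) with hg
  have hodd : ∫ x, g x ∂ballLaw = 0 := integral_ballLaw_eq_zero_of_odd fun x => by
    simp only [hg, hs, d, real_sign_inner_neg, dirInner_neg, abs_neg]
    ring
  have hgi : Integrable g ballLaw := by
    have hs1 : Integrable s ballLaw := by
      simpa using integrable_sign_mul (integrable_const (1 : ℝ)) (blochVec w)
    exact ((((integrable_sign_mul hd.abs _).const_mul q).sub (hd.const_mul q)).add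
      (hs1.const_mul _)).const_mul _
  have hexp (x : R3) : aliceTest w x * bobTest q v x =
      n * q / 2 * |d x| + n * (1 - q) * c / 2 - q / 2 * (n * (s x * d x)) + g x := by
    simp only [aliceTest, bobTest, hg, hs, d, n, c]
    ring
  have hN := norm_mul_integral_sign_mul_dirInner (blochVec w) (blochVec v)
  rw [norm_blochVec] at hN
  have e1 : Integrable (fun x => n * q / 2 * |d x|) ballLaw := hd.abs.const_mul _
  have e2 : Integrable (fun x => n * q / 2 * |d x| + n * (1 - q) * c / 2) ballLaw :=
    e1.add (integrable_const _)
  have e3 : Integrable (fun x => q / 2 * (n * (s x * d x))) ballLaw :=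
    (hsd.const_mul _).const_mul _
  have e4 : Integrable (fun x => n * q / 2 * |d x| + n * (1 - q) * c / 2
      - q / 2 * (n * (s x * d x))) ballLaw := e2.sub e3
  simp only [hexp]
  rw [integral_add e4 hgi, integral_sub e2 e3, integral_add e1 (integrable_const _), hodd,
    integral_const_mul, integral_abs_dirInner, integral_const_mul, integral_const_mul, hN,
    norm_blochVec]
  simp
  ring

/-- The statistics `tr (ρ_E (M ⊗ N))` of the erased singlet
`ρ_E = q |ψ⁻⟩⟨ψ⁻| + (1 - q) (𝕀₂/2) ⊗ |2⟩⟨2|`. -/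
def erasureStat (q : ℝ) (M N : Matrix (Fin 3) (Fin 3) ℂ) : ℂ :=
  (q / 2) * (M 0 0 * N 1 1 - M 0 1 * N 1 0 - M 1 0 * N 0 1 + M 1 1 * N 0 0)
    + (1 - q) / 2 * ((M 0 0 + M 1 1) * N 2 2)

theorem erasureStat_sum_left {ι : Type} (s : Finset ι) (q : ℝ)
    (M : ι → Matrix (Fin 3) (Fin 3) ℂ) (N : Matrix (Fin 3) (Fin 3) ℂ) :
    erasureStat q (∑ i ∈ s, M i) N = ∑ i ∈ s, erasureStat q (M i) N := by
  simp only [erasureStat, Matrix.sum_apply, Finset.sum_add_distrib, ← Finset.mul_sum,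
    Finset.sum_sub_distrib, ← Finset.sum_mul]

theorem erasureStat_sum_right {ι : Type} (s : Finset ι) (q : ℝ)
    (M : Matrix (Fin 3) (Fin 3) ℂ) (N : ι → Matrix (Fin 3) (Fin 3) ℂ) :
    erasureStat q M (∑ i ∈ s, N i) = ∑ i ∈ s, erasureStat q M (N i) := by
  simp only [erasureStat, Matrix.sum_apply, Finset.sum_add_distrib, ← Finset.mul_sum,
    Finset.sum_sub_distrib]

/-- The singlet gives |w₀v₁ - w₁v₀|²/2, and the Bloch vectors express this as a quarter of the
product of the weights minus the inner product. -/
theorem erasureStat_vecMulVec (q : ℝ) (w v : Fin 3 → ℂ) :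
    erasureStat q (Matrix.vecMulVec w (star w)) (Matrix.vecMulVec v (star v)) =
      ((∫ x, aliceTest w x * bobTest q v x ∂ballLaw : ℝ) : ℂ) := by
  rw [integral_aliceTest_mul_bobTest]
  apply Complex.ext <;>
  simp [erasureStat, Matrix.vecMulVec_apply, qubitWeight, blochVec, Complex.normSq_apply,
    PiLp.inner_apply, Fin.sum_univ_three, ← Complex.ofReal_ofNat, Complex.div_re, Complex.div_im] <;>
  ring

/-! ### From tests to response functions, and the local model. -/

/-- Answer according to the tests `G` with weight `1/3`, and otherwise as `|2⟩⟨2|` would. -/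
def completion {A : Type} [Fintype A] (M : POVM A (Fin 3)) (G : A → R3 → ℝ) (a : A) (x : R3) : ℝ :=
  G a x / 3 + (1 - (∑ a', G a' x) / 3) * (M.effect a 2 2).re

theorem isResponse_completion {X : Type} {A : X → Type} [∀ x, Fintype (A x)]
    (M : ∀ x, POVM (A x) (Fin 3)) (G : ∀ x, A x → R3 → ℝ) (hm : ∀ x a, Measurable (G x a))
    (h0 : ∀ x a l, 0 ≤ G x a l) (h3 : ∀ x l, ∑ a, G x a l ≤ 3) :
    IsResponse fun x a l => completion (M x) (G x) a l where
  measurable x a := by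
    unfold completion
    fun_prop
  nonneg x a l := by
    have h1 := h3 x l
    have h2 : 0 ≤ ((M x).effect a 2 2).re :=
      (Complex.le_def.1 ((M x).posSemidef a).diag_nonneg).1
    exact add_nonneg (div_nonneg (h0 x a l) (by norm_num)) (mul_nonneg (by linarith) h2)
  sum_eq_one x l := by
    have : ∑ a, ((M x).effect a 2 2).re = 1 := by
      rw [← Complex.re_sum, ← Matrix.sum_apply, (M x).sum_eq_one, Matrix.one_apply_eq,
        Complex.one_re]
    simp only [completion]
    rw [Finset.sum_add_distrib, ← Finset.mul_sum, this, ← Finset.sum_div]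
    ring

theorem integral_sum_mul_sum {ι κ L : Type} [MeasurableSpace L] {π : Measure L}
    (s : Finset ι) (t : Finset κ) {f : ι → L → ℝ} {g : κ → L → ℝ}
    (h : ∀ i j, Integrable (fun x => f i x * g j x) π) :
    ∫ x, (∑ i ∈ s, f i x) * (∑ j ∈ t, g j x) ∂π =
      ∑ i ∈ s, ∑ j ∈ t, ∫ x, f i x * g j x ∂π := by
  simp only [Finset.sum_mul_sum]
  rw [integral_finsetSum _ fun i _ => integrable_finsetSum _ fun j _ => h i j]
  exact Finset.sum_congr rfl fun i _ => integral_finsetSum _ fun j _ => h i j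

theorem integrable_mul_of_mem_Icc {L : Type} [MeasurableSpace L] {π : Measure L}
    [IsFiniteMeasure π] {f g : L → ℝ} (hf : Measurable f) (hg : Measurable g) {a b : ℝ}
    (hfa : ∀ x, f x ∈ Set.Icc 0 a) (hgb : ∀ x, g x ∈ Set.Icc 0 b) :
    Integrable (fun x => f x * g x) π := by
  refine .of_bound (C := a * b) (hf.mul hg).aestronglyMeasurable (.of_forall fun x => ?_)
  rw [Real.norm_of_nonneg (mul_nonneg (hfa x).1 (hgb x).1)]
  exact mul_le_mul (hfa x).2 (hgb x).2 (hgb x).1 ((hfa x).1.trans (hfa x).2)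

/-- The four terms match the decomposition of ρ_G into ρ_E, its marginals paired with |2⟩⟨2|, and
|22⟩⟨22|. The hypotheses `hGβ` and `hHα` say that summing the correlations over one party's outcomes
gives the other party's marginal. -/
theorem integral_completion_mul_completion {A B : Type} [Fintype A] [Fintype B]
    (M : POVM A (Fin 3)) (N : POVM B (Fin 3)) {G : A → R3 → ℝ} {H : B → R3 → ℝ}
    (hGm : ∀ a, Measurable (G a)) (hHm : ∀ b, Measurable (H b))
    (hG : ∀ a x, 0 ≤ G a x) (hG3 : ∀ x, ∑ a, G a x ≤ 3)
    (hH : ∀ b x, 0 ≤ H b x) (hH3 : ∀ x, ∑ b, H b x ≤ 3)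
    {α : A → ℝ} {β : B → ℝ} (hα : ∀ a, ∫ x, G a x ∂ballLaw = α a)
    (hβ : ∀ b, ∫ x, H b x ∂ballLaw = β b)
    (hGβ : ∀ b, ∑ a, ∫ x, G a x * H b x ∂ballLaw = β b)
    (hHα : ∀ a, ∑ b, ∫ x, G a x * H b x ∂ballLaw = α a)
    (hα1 : ∑ a, α a = 1) (hβ1 : ∑ b, β b = 1) (a : A) (b : B) :
    ∫ x, completion M G a x * completion N H b x ∂ballLaw =
      1 / 9 * (∫ x, G a x * H b x ∂ballLaw + 2 * α a * (N.effect b 2 2).re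
        + 2 * (M.effect a 2 2).re * β b + 4 * (M.effect a 2 2).re * (N.effect b 2 2).re) := by
  set m := (M.effect a 2 2).re
  set n := (N.effect b 2 2).re
  have hGa (a : A) (x : R3) : G a x ∈ Set.Icc 0 3 := ⟨hG a x,
    (Finset.single_le_sum (f := fun a => G a x) (fun a _ => hG a x) (Finset.mem_univ a)).trans
      (hG3 x)⟩
  have hHb (b : B) (x : R3) : H b x ∈ Set.Icc 0 3 := ⟨hH b x,
    (Finset.single_le_sum (f := fun b => H b x) (fun b _ => hH b x) (Finset.mem_univ b)).trans
      (hH3 x)⟩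
  have hone (x : R3) : (1 : ℝ) ∈ Set.Icc (0 : ℝ) 3 := by norm_num
  have hi (a : A) (b : B) : Integrable (fun x => G a x * H b x) ballLaw :=
    integrable_mul_of_mem_Icc (hGm a) (hHm b) (hGa a) (hHb b)
  have hGi (a : A) : Integrable (G a) ballLaw := by
    simpa using integrable_mul_of_mem_Icc (π := ballLaw) (hGm a) measurable_const (hGa a) hone
  have hHi (b : B) : Integrable (H b) ballLaw := by
    simpa using integrable_mul_of_mem_Icc (π := ballLaw) (hHm b) measurable_const (hHb b) hone
  -- Each completion is (1/3)·test - (m/3)·(sum of tests) + m, so the product has nine terms with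
  -- known integrals.
  let F : Fin 3 → R3 → ℝ := ![G a, fun x => ∑ a, G a x, fun _ => 1]
  let K : Fin 3 → R3 → ℝ := ![H b, fun x => ∑ b, H b x, fun _ => 1]
  let c : Fin 3 → ℝ := ![1 / 3, -m / 3, m]
  let e : Fin 3 → ℝ := ![1 / 3, -n / 3, n]
  have hF (i : Fin 3) : Measurable (F i) ∧ ∀ x, F i x ∈ Set.Icc 0 3 := by
    fin_cases i
    · exact ⟨hGm a, hGa a⟩
    · exact ⟨Finset.measurable_sum _ fun a _ => hGm a,
        fun x => ⟨Finset.sum_nonneg fun a _ => hG a x, hG3 x⟩⟩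
    · exact ⟨measurable_const, hone⟩
  have hK (i : Fin 3) : Measurable (K i) ∧ ∀ x, K i x ∈ Set.Icc 0 3 := by
    fin_cases i
    · exact ⟨hHm b, hHb b⟩
    · exact ⟨Finset.measurable_sum _ fun b _ => hHm b,
        fun x => ⟨Finset.sum_nonneg fun b _ => hH b x, hH3 x⟩⟩
    · exact ⟨measurable_const, hone⟩
  have hMc (x : R3) : completion M G a x = ∑ i, c i * F i x := by
    simp [Fin.sum_univ_three, c, F, completion, m]
    ring
  have hNc (x : R3) : completion N H b x = ∑ i, e i * K i x := by
    simp [Fin.sum_univ_three, e, K, completion, n]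
    ring
  have hterm (i j : Fin 3) (x : R3) : c i * F i x * (e j * K j x) = c i * e j * (F i x * K j x) :=
    mul_mul_mul_comm _ _ _ _
  have i01 : ∫ x, G a x * ∑ b, H b x ∂ballLaw = α a := by
    rw [← hHα]
    simp only [Finset.mul_sum]
    exact integral_finsetSum _ fun b _ => hi a b
  have i10 : ∫ x, (∑ a, G a x) * H b x ∂ballLaw = β b := by
    rw [← hGβ]
    simp only [Finset.sum_mul]
    exact integral_finsetSum _ fun a _ => hi a b
  have i11 : ∫ x, (∑ a, G a x) * ∑ b, H b x ∂ballLaw = 1 := by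
    rw [integral_sum_mul_sum _ _ hi, ← hα1]
    exact Finset.sum_congr rfl fun a _ => hHα a
  have i12 : ∫ x, ∑ a, G a x ∂ballLaw = 1 := by
    rw [integral_finsetSum _ fun a _ => hGi a, ← hα1]
    exact Finset.sum_congr rfl fun a _ => hα a
  have i21 : ∫ x, ∑ b, H b x ∂ballLaw = 1 := by
    rw [integral_finsetSum _ fun b _ => hHi b, ← hβ1]
    exact Finset.sum_congr rfl fun b _ => hβ b
  simp only [hMc, hNc]
  rw [integral_sum_mul_sum]
  · simp only [hterm, integral_const_mul]
    simp [Fin.sum_univ_three, c, e, F, K, i01, i10, i11, i12, i21, hα, hβ]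
    ring
  · intro i j
    simp only [hterm]
    exact (integrable_mul_of_mem_Icc (hF i).1 (hK j).1 (hF i).2 (hK j).2).const_mul _

theorem POVM.exists_rankOne_refinement {A : Type} [Fintype A] (M : POVM A (Fin 3)) :
    ∃ (r : A → ℕ) (v : ∀ a, Fin (r a) → Fin 3 → ℂ),
      ∀ a, M.effect a = ∑ i, Matrix.vecMulVec (v a i) (star (v a i)) := by
  choose r v h using fun a => Matrix.posSemidef_iff_eq_sum_vecMulVec.1 (M.posSemidef a)
  exact ⟨r, v, h⟩

theorem effect_apply_self_eq_sum_normSq {A : Type} [Fintype A] (M : POVM A (Fin 3)) {r : A → ℕ}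
    {v : ∀ a, Fin (r a) → Fin 3 → ℂ}
    (h : ∀ a, M.effect a = ∑ i, Matrix.vecMulVec (v a i) (star (v a i))) (a : A) (j : Fin 3) :
    M.effect a j j = ((∑ i, Complex.normSq (v a i j) : ℝ) : ℂ) := by
  rw [h, Matrix.sum_apply]
  simp [Matrix.vecMulVec_apply, Complex.mul_conj]

/-- The squared norms of all rank-one pieces add up to the trace of the identity on ℂ³; hence the
weight 1/3 in `completion`. -/
theorem sum_tests_le {A : Type} [Fintype A] (M : POVM A (Fin 3)) {r : A → ℕ}
    {v : ∀ a, Fin (r a) → Fin 3 → ℂ}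
    (h : ∀ a, M.effect a = ∑ i, Matrix.vecMulVec (v a i) (star (v a i)))
    {T : (Fin 3 → ℂ) → R3 → ℝ} (hT : ∀ w x, T w x ∈ Set.Icc 0 (∑ i, Complex.normSq (w i)))
    (x : R3) : ∑ a, ∑ i, T (v a i) x ≤ 3 := by
  refine (Finset.sum_le_sum fun a _ => Finset.sum_le_sum fun i _ => (hT (v a i) x).2).trans_eq ?_
  have h1 (j : Fin 3) : ∑ a, ∑ i, Complex.normSq (v a i j) = 1 := by
    have := congrFun (congrFun M.sum_eq_one j) j
    rw [Matrix.sum_apply, Matrix.one_apply_eq] at this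
    simp only [effect_apply_self_eq_sum_normSq M h] at this
    exact_mod_cast this
  simp only [Fin.sum_univ_three, Finset.sum_add_distrib, h1]
  norm_num

theorem isLocalForPOVMs_rhoG {q : ℝ} (hq : 0 < q) (hq2 : q ≤ 1 / 2) :
    IsLocalForPOVMs (rhoG q) := by
  intro X Y A B _ _ M N
  choose r v hv using fun x => (M x).exists_rankOne_refinement
  choose r' w hw using fun y => (N y).exists_rankOne_refinement
  set G : ∀ x, A x → R3 → ℝ := fun x a l => ∑ i, aliceTest (v x a i) l with hGdef
  set H : ∀ y, B y → R3 → ℝ := fun y b l => ∑ i, bobTest q (w y b i) l with hHdef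
  have hA := aliceTest_mem_Icc
  have hB := bobTest_mem_Icc hq.le hq2
  have hGm (x : X) (a : A x) : Measurable (G x a) := by
    simp only [hGdef]
    fun_prop
  have hHm (y : Y) (b : B y) : Measurable (H y b) := by
    simp only [hHdef]
    fun_prop
  have hG0 (x : X) (a : A x) (l : R3) : 0 ≤ G x a l := Finset.sum_nonneg fun i _ => (hA _ l).1
  have hH0 (y : Y) (b : B y) (l : R3) : 0 ≤ H y b l := Finset.sum_nonneg fun i _ => (hB _ l).1
  have hG3 (x : X) := sum_tests_le (M x) (hv x) hA
  have hH3 (y : Y) := sum_tests_le (N y) (hw y) hB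
  refine ⟨R3, inferInstance, ballLaw, inferInstance, fun x => completion (M x) (G x),
    fun y => completion (N y) (H y), isResponse_completion M G hGm hG0 hG3,
    isResponse_completion N H hHm hH0 hH3, fun x y a b => ?_⟩
  have hdM (a : A x) (j : Fin 3) : (M x).effect a j j = (((M x).effect a j j).re : ℂ) := by
    rw [effect_apply_self_eq_sum_normSq (M x) (hv x), Complex.ofReal_re]
  have hdN (b : B y) (j : Fin 3) : (N y).effect b j j = (((N y).effect b j j).re : ℂ) := by
    rw [effect_apply_self_eq_sum_normSq (N y) (hw y), Complex.ofReal_re]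
  have hα (a : A x) : ∫ l, G x a l ∂ballLaw =
      (((M x).effect a 0 0).re + ((M x).effect a 1 1).re) / 2 := by
    simp only [hGdef]
    rw [integral_finsetSum]
    · simp only [integral_aliceTest, effect_apply_self_eq_sum_normSq (M x) (hv x), Complex.ofReal_re,
        qubitWeight, Finset.sum_add_distrib, ← Finset.sum_div]
    · intro i _
      simpa using integrable_mul_of_mem_Icc (π := ballLaw) (measurable_aliceTest (v x a i))
        measurable_const (hA (v x a i)) fun _ => Set.right_mem_Icc.2 (zero_le_one (α := ℝ))
  have hβ (b : B y) : ∫ l, H y b l ∂ballLaw =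
      q * (((N y).effect b 0 0).re + ((N y).effect b 1 1).re) / 2
        + (1 - q) * ((N y).effect b 2 2).re := by
    simp only [hHdef]
    rw [integral_finsetSum]
    · simp only [integral_bobTest, effect_apply_self_eq_sum_normSq (N y) (hw y), Complex.ofReal_re,
        qubitWeight, Finset.sum_add_distrib, ← Finset.sum_div, ← Finset.mul_sum]
    · intro i _
      simpa using integrable_mul_of_mem_Icc (π := ballLaw) (measurable_bobTest q (w y b i))
        measurable_const (hB (w y b i)) fun _ => Set.right_mem_Icc.2 (zero_le_one (α := ℝ))
  have hC (a : A x) (b : B y) : ((∫ l, G x a l * H y b l ∂ballLaw : ℝ) : ℂ) =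
      erasureStat q ((M x).effect a) ((N y).effect b) := by
    simp only [hGdef, hHdef]
    rw [integral_sum_mul_sum _ _ fun i j => integrable_mul_of_mem_Icc (measurable_aliceTest _)
      (measurable_bobTest q _) (hA _) (hB _), hv, hw, erasureStat_sum_left]
    simp only [erasureStat_sum_right, erasureStat_vecMulVec, Complex.ofReal_sum]
  have hM1 (j : Fin 3) : ∑ a, ((M x).effect a j j).re = 1 := by
    rw [← Complex.re_sum, ← Matrix.sum_apply, (M x).sum_eq_one, Matrix.one_apply_eq,
      Complex.one_re]
  have hN1 (j : Fin 3) : ∑ b, ((N y).effect b j j).re = 1 := by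
    rw [← Complex.re_sum, ← Matrix.sum_apply, (N y).sum_eq_one, Matrix.one_apply_eq,
      Complex.one_re]
  rw [integral_completion_mul_completion (M x) (N y) (hGm x) (hHm y) (hG0 x) (hG3 x) (hH0 y)
    (hH3 y) hα hβ]
  · refine (trace_rhoG_mul_kronecker q _ _).trans ?_
    push_cast
    rw [hC, erasureStat]
    simp only [← hdM, ← hdN]
    ring
  · intro b
    apply Complex.ofReal_injective
    rw [Complex.ofReal_sum]
    simp only [hC]
    rw [← erasureStat_sum_left, (M x).sum_eq_one]
    push_cast
    simp only [← hdN]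
    simp [erasureStat]
    ring
  · intro a
    apply Complex.ofReal_injective
    rw [Complex.ofReal_sum]
    simp only [hC]
    rw [← erasureStat_sum_right, (N y).sum_eq_one]
    push_cast
    simp only [← hdM]
    simp [erasureStat]
    ring
  · rw [← Finset.sum_div, Finset.sum_add_distrib, hM1, hM1]
    norm_num
  · rw [Finset.sum_add_distrib, ← Finset.sum_div, ← Finset.mul_sum, Finset.sum_add_distrib, hN1,
      hN1, ← Finset.mul_sum, hN1]
    ring

/-! ### Steering by too many pure conditional states. -/

/-- The quadratic form of the leading `2 × 2` block of a positive semidefinite matrix is nonnegative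
on real vectors. -/
theorem posSemidef_block_form_nonneg {T : Matrix (Fin 3) (Fin 3) ℂ} (hT : T.PosSemidef) (z : ℂ) :
    0 ≤ (T 0 0).re + (z * T 0 1 + star z * T 1 0).re + Complex.normSq z * (T 1 1).re := by
  have h := hT.dotProduct_mulVec_nonneg ![1, z, 0]
  have h' := (Complex.le_def.1 h).1
  simp [dotProduct, Matrix.mulVec, Fin.sum_univ_three] at h'
  simp [Complex.normSq_apply]
  nlinarith

theorem posSemidef_diag_re_nonneg {n : Type} [Fintype n] {T : Matrix n n ℂ} (hT : T.PosSemidef)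
    (i : n) : 0 ≤ (T i i).re := (Complex.le_def.1 hT.diag_nonneg).1

theorem IsDensityMatrix.block_trace_le_one {T : Matrix (Fin 3) (Fin 3) ℂ} (hT : IsDensityMatrix T) :
    (T 0 0).re + (T 1 1).re ≤ 1 := by
  have h := congrArg Complex.re hT.2
  simp [Matrix.trace, Fin.sum_univ_three] at h
  linarith [posSemidef_diag_re_nonneg hT.1 2]

/-- The block form at ±1 and ±i bounds the real and imaginary parts by 1/2. This crude bound serves
only integrability. -/
theorem IsDensityMatrix.norm_apply_zero_one_le {T : Matrix (Fin 3) (Fin 3) ℂ}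
    (hT : IsDensityMatrix T) : ‖T 0 1‖ ≤ 1 := by
  have ht := hT.block_trace_le_one
  have hj : T 1 0 = star (T 0 1) := (hT.1.1.apply 1 0).symm
  have h1 := posSemidef_block_form_nonneg hT.1 1
  have h2 := posSemidef_block_form_nonneg hT.1 (-1)
  have h3 := posSemidef_block_form_nonneg hT.1 Complex.I
  have h4 := posSemidef_block_form_nonneg hT.1 (-Complex.I)
  rw [hj] at h1 h2 h3 h4
  simp at h1 h2 h3 h4
  refine (Complex.norm_le_abs_re_add_abs_im _).trans ?_
  have a1 : |(T 0 1).re| ≤ 1 / 2 := abs_le.2 ⟨by linarith, by linarith⟩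
  have a2 : |(T 0 1).im| ≤ 1 / 2 := abs_le.2 ⟨by linarith, by linarith⟩
  linarith

/-- A nonnegative quadratic polynomial with two distinct zeros vanishes. -/
theorem quadratic_eq_zero_of_two_zeros {a s b x y : ℝ} (h : ∀ z : ℝ, 0 ≤ a + z * s + z ^ 2 * b)
    (hb : 0 ≤ b) (hxy : x ≠ y) (hx : a + x * s + x ^ 2 * b = 0) (hy : a + y * s + y ^ 2 * b = 0) :
    a + b = 0 := by
  have hd : 0 < (x - y) ^ 2 := by have := sub_ne_zero.2 hxy; positivity
  have hb0 : b = 0 := by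
    -- With zeros at `x` and `y`, the value at the midpoint is -b(x - y)²/4, which forces b = 0.
    have := h ((x + y) / 2)
    nlinarith
  subst hb0
  have hs : s = 0 := by
    have : (x - y) * s = 0 := by linarith
    exact (mul_eq_zero.1 this).resolve_left (sub_ne_zero.2 hxy)
  subst hs
  linarith

/-- Applied at a fixed hidden state: `p k` is the response to setting `k` and `t` the qubit-block
trace, which vanishes as soon as two settings respond. -/
theorem sum_mul_le_of_at_most_one {ι : Type} [Fintype ι] {p : ι → ℝ} {t : ℝ}
    (hp : ∀ k, p k ≤ 1) (ht : 0 ≤ t) (h : ∀ j k, j ≠ k → p j ≠ 0 → p k ≠ 0 → t = 0) :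
    ∑ k, p k * t ≤ t := by
  classical
  by_cases h0 : ∀ k, p k = 0
  · simpa [h0] using ht
  · push Not at h0
    obtain ⟨k, hk⟩ := h0
    rw [Finset.sum_eq_single k (fun j _ hj => ?_) (by simp)]
    · exact mul_le_of_le_one_left ht (hp k)
    · by_contra hne
      rw [h j k hj (left_ne_zero_of_mul hne) hk, mul_zero] at hne
      exact hne rfl

/-- A two-outcome assemblage whose first outcomes produce too many distinct pure states on the
qubit block has no local hidden state decomposition. -/
theorem not_hasLHSDecomposition_of_pure_outcomes {K : ℕ} (hK : 0 < K) {ε W : ℝ} (hεW : W < K * ε)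
    (σ : Fin K → Bool → Matrix (Fin 3) (Fin 3) ℂ)
    (hnull : ∀ k, σ k true 0 0 + (k : ℂ) * σ k true 0 1 + (k : ℂ) * σ k true 1 0
      + (k : ℂ) ^ 2 * σ k true 1 1 = 0)
    (hε : ∀ k, σ k true 0 0 + σ k true 1 1 = ε)
    (hW : ∀ k, ∑ a, (σ k a 0 0 + σ k a 1 1) = W) :
    ¬ HasLHSDecomposition (A := fun _ => Bool) σ := by
  rintro ⟨L, _, π, _, p, τ, hp, hτm, hτ, hσ⟩
  have hp1 (k : Fin K) (a : Bool) (l : L) : p k a l ≤ 1 :=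
    (hp.sum_eq_one k l) ▸ Finset.single_le_sum (f := fun a => p k a l)
      (fun a _ => hp.nonneg k a l) (Finset.mem_univ a)
  have hint {i j : Fin 3} (hb : ∀ l, ‖τ l i j‖ ≤ 1) (k : Fin K) (a : Bool) :
      Integrable (fun l => (p k a l : ℂ) * τ l i j) π := by
    refine Integrable.of_bound (C := 1) ?_ (Filter.Eventually.of_forall fun l => ?_)
    · exact ((Complex.measurable_ofReal.comp (hp.measurable k a)).mul
        (hτm i j)).aestronglyMeasurable
    · rw [norm_mul, Complex.norm_real, Real.norm_of_nonneg (hp.nonneg k a l)]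
      exact mul_le_one₀ (hp1 k a l) (norm_nonneg _) (hb l)
  have hdiag (l : L) (i : Fin 3) : ‖τ l i i‖ = (τ l i i).re :=
    congrArg Complex.re (Complex.norm_of_nonneg' ((hτ l).1.diag_nonneg (i := i)))
  -- Only the qubit block enters the argument, so indices range over `Fin 2` embedded in `Fin 3`.
  have hb (i j : Fin 2) (l : L) : ‖τ l i.castSucc j.castSucc‖ ≤ 1 := by
    have h0 := posSemidef_diag_re_nonneg (hτ l).1 0
    have h1 := posSemidef_diag_re_nonneg (hτ l).1 1
    have ht := (hτ l).block_trace_le_one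
    have h01 := (hτ l).norm_apply_zero_one_le
    fin_cases i <;> fin_cases j
    · exact (hdiag l 0).trans_le (by linarith)
    · exact h01
    · exact (congrArg norm ((hτ l).1.1.apply 1 0)).symm.trans_le ((norm_star _).trans_le h01)
    · exact (hdiag l 1).trans_le (by linarith)
  have hI (i j : Fin 2) (k : Fin K) (a : Bool) :
      Integrable (fun l => p k a l * (τ l i.castSucc j.castSucc).re) π := by
    simpa using (hint (hb i j) k a).re
  have hre (i j : Fin 2) (k : Fin K) (a : Bool) : (σ k a i.castSucc j.castSucc).re =
      ∫ l, p k a l * (τ l i.castSucc j.castSucc).re ∂π := by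
    rw [hσ]
    refine (integral_re (hint (hb i j) k a)).symm.trans ?_
    simp
  set t : L → ℝ := fun l => (τ l 0 0).re + (τ l 1 1).re with ht_def
  set Q : ℝ → L → ℝ := fun x l => (τ l 0 0).re + x * ((τ l 0 1).re + (τ l 1 0).re)
    + x ^ 2 * (τ l 1 1).re with hQ_def
  have hQ0 (x : ℝ) (l : L) : 0 ≤ Q x l := by
    have := posSemidef_block_form_nonneg (hτ l).1 x
    simp [Complex.normSq_apply] at this
    simp only [hQ_def]
    linarith
  have ht0 (l : L) : 0 ≤ t l :=
    add_nonneg (posSemidef_diag_re_nonneg (hτ l).1 0) (posSemidef_diag_re_nonneg (hτ l).1 1)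
  have htI (k : Fin K) (a : Bool) : Integrable (fun l => p k a l * t l) π :=
    ((hI 0 0 k a).add (hI 1 1 k a)).congr (.of_forall fun l => (mul_add _ _ _).symm)
  have htre (k : Fin K) (a : Bool) :
      (σ k a 0 0 + σ k a 1 1).re = ∫ l, p k a l * t l ∂π := by
    rw [Complex.add_re]
    refine (congrArg₂ (· + ·) (hre 0 0 k a) (hre 1 1 k a)).trans ?_
    rw [← integral_add (hI 0 0 k a) (hI 1 1 k a)]
    exact integral_congr_ae (.of_forall fun l => (mul_add _ _ _).symm)
  -- The integrand is nonnegative and integrates to the form of `σ k true` at (1, k), which is zero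
  -- by `hnull`.
  have hQint (k : Fin K) : ∀ᵐ l ∂π, p k true l * Q k l = 0 := by
    have e1 := (hI 0 1 k true).const_mul (k : ℝ)
    have e2 := (hI 1 0 k true).const_mul (k : ℝ)
    have e3 := (hI 1 1 k true).const_mul ((k : ℝ) ^ 2)
    have hsum (l : L) : p k true l * Q k l = p k true l * (τ l 0 0).re
        + (k : ℝ) * (p k true l * (τ l 0 1).re) + (k : ℝ) * (p k true l * (τ l 1 0).re)
        + (k : ℝ) ^ 2 * (p k true l * (τ l 1 1).re) := by simp only [hQ_def]; ring
    have hi : Integrable (fun l => p k true l * Q k l) π :=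
      ((((hI 0 0 k true).add e1).add e2).add e3).congr (.of_forall fun l => (hsum l).symm)
    refine (integral_eq_zero_iff_of_nonneg (fun l => mul_nonneg (hp.nonneg _ _ _) (hQ0 _ _))
      hi).1 ?_
    have := congrArg Complex.re (hnull k)
    rw [← Complex.ofReal_natCast, ← Complex.ofReal_pow] at this
    simp only [Complex.add_re, Complex.re_ofReal_mul, Complex.zero_re] at this
    rw [← this]
    refine Eq.trans ?_ (congrArg₂ (· + ·) (congrArg₂ (· + ·) (congrArg₂ (· + ·)
      (hre 0 0 k true) (congrArg ((k : ℝ) * ·) (hre 0 1 k true)))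
      (congrArg ((k : ℝ) * ·) (hre 1 0 k true)))
      (congrArg ((k : ℝ) ^ 2 * ·) (hre 1 1 k true))).symm
    simp only [← integral_const_mul]
    rw [← integral_add (hI 0 0 k true) e1]
    refine Eq.trans ?_ (congrArg (· + _) (integral_add ((hI 0 0 k true).add e1) e2))
    refine Eq.trans ?_ (integral_add (((hI 0 0 k true).add e1).add e2) e3)
    exact integral_congr_ae (.of_forall hsum)
  -- Summing over the outcomes of any one setting removes the response; `hK` supplies a setting.
  have htW : ∫ l, t l ∂π = W := by
    have hs (l : L) : t l = ∑ a, p ⟨0, hK⟩ a l * t l := by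
      rw [← Finset.sum_mul, hp.sum_eq_one, one_mul]
    have h := congrArg Complex.re (hW ⟨0, hK⟩)
    rw [Complex.re_sum, Complex.ofReal_re] at h
    rw [← h, integral_congr_ae (.of_forall hs), integral_finsetSum _ fun a _ => htI _ a]
    exact Finset.sum_congr rfl fun a _ => (htre _ a).symm
  have htint : Integrable t π := by
    refine (integrable_finsetSum Finset.univ fun a _ => htI ⟨0, hK⟩ a).congr
      (.of_forall fun l => ?_)
    simp only [← Finset.sum_mul, hp.sum_eq_one, one_mul]
  have hle : ∀ᵐ l ∂π, ∑ k, p k true l * t l ≤ t l := by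
    filter_upwards [ae_all_iff.2 hQint] with l hl
    refine sum_mul_le_of_at_most_one (fun k => hp1 k true l) (ht0 l) fun j k hjk hj hk => ?_
    exact quadratic_eq_zero_of_two_zeros (fun z => hQ0 z l)
      (posSemidef_diag_re_nonneg (hτ l).1 1)
      (fun h => hjk (Fin.ext (Nat.cast_injective (R := ℝ) h)))
      ((mul_eq_zero.1 (hl j)).resolve_left hj) ((mul_eq_zero.1 (hl k)).resolve_left hk)
  have hfin := integral_mono_ae (integrable_finsetSum _ fun k _ => htI k true) htint hle
  rw [integral_finsetSum _ fun k _ => htI k true, htW] at hfin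
  have hεk (k : Fin K) : ∫ l, p k true l * t l ∂π = ε := by
    rw [← htre, hε, Complex.ofReal_re]
  simp only [hεk, Finset.sum_const, Finset.card_univ, Fintype.card_fin, nsmul_eq_mul] at hfin
  linarith

/-- The dichotomic measurement of the unit vector proportional to `|0⟩ + k |1⟩`. -/
def qubitPOVM (k : ℕ) : POVM Bool (Fin 3) where
  effect a := if a then (1 / (1 + (k : ℂ) ^ 2)) • Matrix.vecMulVec ![1, (k : ℂ), 0]
      (star ![1, (k : ℂ), 0])
    else (1 / (1 + (k : ℂ) ^ 2)) • Matrix.vecMulVec ![(k : ℂ), -1, 0] (star ![(k : ℂ), -1, 0])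
      + Matrix.vecMulVec ![0, 0, 1] (star ![0, 0, 1])
  posSemidef a := by
    have h : (0 : ℂ) ≤ 1 / (1 + (k : ℂ) ^ 2) := by
      have : (0 : ℝ) ≤ 1 / (1 + (k : ℝ) ^ 2) := by positivity
      simpa using Complex.zero_le_real.2 this
    cases a
    · exact ((Matrix.posSemidef_vecMulVec_self_star _).smul h).add
        (Matrix.posSemidef_vecMulVec_self_star _)
    · exact (Matrix.posSemidef_vecMulVec_self_star _).smul h
  sum_eq_one := by
    have h : (1 + (k : ℂ) ^ 2) ≠ 0 := by
      have : (1 + (k : ℝ) ^ 2) ≠ 0 := by positivity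
      exact_mod_cast this
    ext i j
    simp only [Fintype.sum_bool, if_true, Bool.false_eq_true, if_false, Matrix.add_apply,
      Matrix.smul_apply, Matrix.vecMulVec_apply, Pi.star_apply, smul_eq_mul]
    fin_cases i <;> fin_cases j <;> simp <;> field_simp
    ring

theorem qubitPOVM_effect_true (k : ℕ) : (qubitPOVM k).effect true =
    (1 / (1 + (k : ℂ) ^ 2)) • !![1, (k : ℂ), 0; (k : ℂ), (k : ℂ) ^ 2, 0; 0, 0, 0] := by
  ext i j
  simp only [qubitPOVM, if_true, Matrix.smul_apply, Matrix.vecMulVec_apply, Pi.star_apply]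
  fin_cases i <;> fin_cases j <;> simp [pow_two]

theorem one_add_natCast_sq_ne_zero (k : ℕ) : (1 + (k : ℂ) ^ 2) ≠ 0 := by
  have : (1 + (k : ℝ) ^ 2) ≠ 0 := by positivity
  exact_mod_cast this

theorem isSteerableAliceToBob_rhoG {q : ℝ} (hq : 0 < q) : IsSteerableAliceToBob (rhoG q) := by
  refine ⟨Fin 7, inferInstance, fun _ => Bool, fun _ => inferInstance, fun k => qubitPOVM k,
    -- The `true` effect annihilates |2⟩, so only the singlet contributes to ε = (q/9)/2. Bob's
    -- total block trace is q/9 + 2q/9 = q/3 = 6ε, so seven settings suffice for every q.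
    not_hasLHSDecomposition_of_pure_outcomes (ε := q / 18) (W := q / 3) (by norm_num)
      (by push_cast; linarith) _ (fun k => ?_) (fun k => ?_) (fun k => ?_)⟩
  · simp only [trFst_apply_eq_trace, trace_rhoG_mul_kronecker, qubitPOVM_effect_true]
    simp
    ring
  · have := one_add_natCast_sq_ne_zero k
    simp only [trFst_apply_eq_trace, trace_rhoG_mul_kronecker, qubitPOVM_effect_true]
    simp
    field_simp
    ring
  · have h (i : Fin 3) : ∑ a, (qubitPOVM k).effect a i i = 1 := by
      rw [← Matrix.sum_apply, (qubitPOVM k).sum_eq_one, Matrix.one_apply_eq]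
    have h0 := h 0
    have h1 := h 1
    have h2 := h 2
    simp only [Fintype.sum_bool] at h0 h1 h2
    simp only [trFst_apply_eq_trace, trace_rhoG_mul_kronecker, Fintype.sum_bool]
    simp
    linear_combination (q / 18 : ℂ) * h0 + (q / 18 : ℂ) * h1 + (2 * q / 9 : ℂ) * h2

theorem isSteerableBobToAlice_rhoG {q : ℝ} (hq : 0 < q) : IsSteerableBobToAlice (rhoG q) := by
  -- Alice's block trace is q/9 + (3 - q)/9 = 1/3 whatever q is, while ε = q/18; the number of
  -- settings must exceed 6/q.
  obtain ⟨K, hK⟩ := exists_nat_gt (6 / q)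
  have hK0 : 0 < K := Nat.cast_pos.1 ((by positivity : (0 : ℝ) < 6 / q).trans hK)
  rw [div_lt_iff₀ hq] at hK
  refine ⟨Fin K, inferInstance, fun _ => Bool, fun _ => inferInstance, fun k => qubitPOVM k,
    not_hasLHSDecomposition_of_pure_outcomes (ε := q / 18) (W := 1 / 3) hK0
      (by linarith) _ (fun k => ?_) (fun k => ?_) (fun k => ?_)⟩
  · simp only [trSnd_apply_eq_trace, trace_rhoG_mul_kronecker, qubitPOVM_effect_true]
    simp
    ring
  · have := one_add_natCast_sq_ne_zero k
    simp only [trSnd_apply_eq_trace, trace_rhoG_mul_kronecker, qubitPOVM_effect_true]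
    simp
    field_simp
    ring
  · have h (i : Fin 3) : ∑ a, (qubitPOVM k).effect a i i = 1 := by
      rw [← Matrix.sum_apply, (qubitPOVM k).sum_eq_one, Matrix.one_apply_eq]
    have h0 := h 0
    have h1 := h 1
    have h2 := h 2
    simp only [Fintype.sum_bool] at h0 h1 h2
    simp only [trSnd_apply_eq_trace, trace_rhoG_mul_kronecker, Fintype.sum_bool]
    simp
    linear_combination (q / 18 : ℂ) * h0 + (q / 18 : ℂ) * h1 + ((3 - q) / 9 : ℂ) * h2

end QSteering

end

theorem mainTheorem3 (q : ℝ) (hq : 0 < q) (hq1 : q ≤ 1) :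
    QSteering.IsDensityMatrix (QSteering.rhoG q) ∧
      QSteering.IsSteerableAliceToBob (QSteering.rhoG q) ∧
      QSteering.IsSteerableBobToAlice (QSteering.rhoG q) ∧
      (q ≤ 1 / 2 → QSteering.IsLocalForPOVMs (QSteering.rhoG q)) :=
  ⟨QSteering.isDensityMatrix_rhoG hq hq1, QSteering.isSteerableAliceToBob_rhoG hq,
    QSteering.isSteerableBobToAlice_rhoG hq, QSteering.isLocalForPOVMs_rhoG hq⟩
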